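/- Let $K$ be a complete discretely valued field with normalised valuation $v_K$ (so $v_K(K^\times)=\mathbb Z$) and ring of integers $O_K$; extend $v_K$ to an algebraic closure $\bar K$. Put $\hat{\mathbb Q}=\mathbb Q\cup\{\infty\}$. A pseudo-valuation on $K[x]$ extending $v_K$ is a map $v:K[x]\to\hat{\mathbb Q}$ with $v|_K=v_K$, $v(ab)=v(a)+v(b)$ and $v(a+b)\ge\min\{v(a),v(b)\}$; it is a valuation if $v(a)=\infty$ only for $a=0$. Write $v\le w$ if $v(g)\le w(g)$ for all $g\in K[x]$. The Gauss valuation is $v_0(\sum_i c_ix^i)=\min_i v_K(c_i)$. For a valuation $v$, say that $h$ $v$-divides $g$ if $v(g-qh)>v(g)$ for some $q\in K[x]$. A key polynomial over $v$ is a non-constant monic $\phi\in K[x]$ such that, for all $a,b\in K[x]$: if $\phi$ $v$-divides $ab$ then $\phi$ $v$-divides $a$ or $b$; and if $\phi$ $v$-divides $a$ then $\deg a\ge\deg\phi$. For such $\phi$ and $\lambda\in\hat{\mathbb Q}$ with $\lambda>v(\phi)$, the augmentation $[v,w(\phi)=\lambda]$ is the pseudo-valuation $w$ with $w(\sum_i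 a_i\phi^i)=\min_i(v(a_i)+i\lambda)$ whenever $\deg a_i<\deg\phi$ for all $i$. A MacLane pseudo-valuation is one obtained from $v_0$ by finitely many (possibly zero) augmentations, all but the last one being valuations. If the last augmentation of $v$ is with respect to $(\phi,\lambda)$, then the degree of $v$ is $\deg v=\deg\phi$ and the radius of $v$ is $\lambda_v=\lambda$ (these depend only on $v$); by convention $\deg v_0=1$ and $\lambda_{v_0}=0$. Put $$D_v=\{\alpha\in\bar K\mid v_K(g(\alpha))\ge v(g)\text{ for all }g\in K[x]\}.$$ Let $f\in K[x]$ be a separable polynomial with leading coefficient $c_f$ such that $f/c_f\in O_K[x]$, and let $\mathfrak R\subset\bar K$ be its set of roots. A MacLane cluster for $f$ is a pair $(\mathfrak s,v)$ where $v$ is a MacLane pseudo-valuation, $\mathfrak s=D_v\cap\mathfrak R\neq\varnothing$, and every MacLane valuation $w>v$ with $D_w\cap\mathfrak R=\mathfrak s$ satisfies $\deg w>\deg v$. **Lemma.** Let $v$ be a MacLane pseudo-valuation and let $\mathfrak s=D_v\cap\mathfrak R$. Then $(\mathfrak s,v)$ is a MacLane cluster for $f$ if and only if $$\lambda_v=\max_{g}\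 \min_{r\in\mathfrak s}v_K(g(r)),$$ where $g$ runs over the monic irreducible polynomials in $K[x]$ of degree $\deg g\le\deg v$. (The right-hand condition includes that the maximum exists and is attained; if $\mathfrak s=\varnothing$ the minimum does not exist and the condition is understood to fail.) -/

import Mathlib

open Polynomial
open scoped WithZero

namespace MacLane

noncomputable section

section Valuations

variable (K : Type*) [Field K] [Valued K ℤᵐ⁰]

/-- The discrete valuation of `K` written additively, with values in `ℚ ∪ {∞}`. It is the
normalised valuation `v_K` as soon as `Valued.v : K → ℤᵐ⁰` is surjective. -/
def vK (c : K) : WithTop ℚ :=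
  open Classical in
  if c = 0 then ⊤ else (((-WithZero.log (Valued.v c : ℤᵐ⁰) : ℤ) : ℚ) : WithTop ℚ)

/-- The extension of `v_K` to an algebraic closure of the complete field `K`:
`v_K(α) = v_K(N(α)) / [K(α) : K]` where `N` is the norm of `K(α) / K`. Up to sign `N(α)` is the
constant coefficient of the minimal polynomial of `α`, whose degree is `[K(α) : K]`. -/
def vKbar {L : Type*} [Field L] [Algebra K L] (α : L) : WithTop ℚ :=
  (vK K ((minpoly K α).coeff 0)).map (fun q : ℚ => q / ((minpoly K α).natDegree : ℚ))

end Valuations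

variable {K : Type*} [Field K]

/-- The pseudo-valuations `K[x] → ℚ ∪ {∞}`; the value `∞` may be taken at nonzero polynomials. -/
abbrev PseudoVal (K : Type*) [Field K] := AddValuation K[X] (WithTop ℚ)

/-- A pseudo-valuation is a valuation if it takes the value `∞` at `0` only. -/
def IsVal (v : PseudoVal K) : Prop := ∀ g : K[X], v g = ⊤ ↔ g = 0

/-- The strict order `v < w` on pseudo-valuations: `v ≤ w` pointwise and `v ≠ w`. -/
def Below (v w : PseudoVal K) : Prop := (∀ g : K[X], v g ≤ w g) ∧ v ≠ w

/-- `h` divides `g` up to `v`-equivalence: some `q` satisfies `v (g - q h) > v g`. -/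
def VDvd (v : PseudoVal K) (h g : K[X]) : Prop := ∃ q : K[X], v g < v (g - q * h)

/-- Key polynomials over `v`: non-constant monic polynomials that are `v`-irreducible and
`v`-minimal. -/
structure IsKeyPoly (v : PseudoVal K) (φ : K[X]) : Prop where
  monic : φ.Monic
  natDegree_pos : 0 < φ.natDegree
  irreducible : ∀ a b : K[X], VDvd v φ (a * b) → VDvd v φ a ∨ VDvd v φ b
  minimal : ∀ a : K[X], VDvd v φ a → φ.natDegree ≤ a.natDegree

/-- `w = [v, w(φ) = l]`, i.e. `w (∑ aᵢ φⁱ) = minᵢ (v aᵢ + i l)` whenever `deg aᵢ < deg φ`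
for all `i`. The coefficient `aᵢ` in the `φ`-adic expansion of `g` is the remainder modulo `φ` of
the quotient of `g` by `φⁱ`, and it vanishes for `i > deg g`. -/
def IsAugmentation (v : PseudoVal K) (φ : K[X]) (l : WithTop ℚ) (w : PseudoVal K) : Prop :=
  ∀ g : K[X], w g =
    (Finset.range (g.natDegree + 1)).inf fun i => v ((g /ₘ φ ^ i) %ₘ φ) + i • l

variable [Valued K ℤᵐ⁰]

/-- The Gauss valuation `v₀ (∑ cᵢ xⁱ) = minᵢ v_K(cᵢ)`. -/
def IsGauss (v : PseudoVal K) : Prop :=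
  ∀ g : K[X], v g = g.support.inf fun i => vK K (g.coeff i)

/-- `HasCentreRadius v φ l`: the pseudo-valuation `v` arises from the Gauss valuation by finitely
many augmentations, the last one being with respect to `(φ, l)`. By convention the Gauss valuation
has radius `0`, and its centres are the monic integral polynomials of degree `1`. -/
inductive HasCentreRadius : PseudoVal K → K[X] → WithTop ℚ → Prop
  | gauss (v : PseudoVal K) (φ : K[X]) (hv : IsGauss v) (monic : φ.Monic)
      (degree_one : φ.natDegree = 1) (integral : ∀ i, 0 ≤ vK K (φ.coeff i)) :
      HasCentreRadius v φ 0
  | augment (v : PseudoVal K) (ψ : K[X]) (m : WithTop ℚ) (w : PseudoVal K) (φ : K[X])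
      (l : WithTop ℚ) (hv : HasCentreRadius v ψ m) (val : IsVal v) (key : IsKeyPoly v φ)
      (lt : v φ < l) (aug : IsAugmentation v φ l w) : HasCentreRadius w φ l

/-- MacLane pseudo-valuations. -/
def IsMacLane (v : PseudoVal K) : Prop := ∃ φ l, HasCentreRadius v φ l

/-- The degree of a MacLane pseudo-valuation: the degree of any of its centres
(see `HasCentreRadius.degree_eq`). -/
def degree (v : PseudoVal K) : ℕ :=
  Classical.epsilon fun d => ∃ φ l, HasCentreRadius v φ l ∧ φ.natDegree = d

/-- The radius of a MacLane pseudo-valuation (see `HasCentreRadius.radius_eq`). -/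
def radius (v : PseudoVal K) : WithTop ℚ :=
  Classical.epsilon fun l => ∃ φ, HasCentreRadius v φ l

/-- The discoid `D_v` of a MacLane pseudo-valuation `v`. -/
def discoid (L : Type*) [Field L] [Algebra K L] (v : PseudoVal K) : Set L :=
  {α | ∀ g : K[X], v g ≤ vKbar K (aeval α g)}

/-- MacLane clusters `(s, v)` for `f`, where `f.rootSet L` is the set of roots of `f` in `L`. -/
structure IsCluster {L : Type*} [Field L] [Algebra K L] (f : K[X]) (s : Set L)
    (v : PseudoVal K) : Prop where
  isMacLane : IsMacLane v
  eq_inter : s = discoid L v ∩ f.rootSet L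
  nonempty : s.Nonempty
  degree_lt : ∀ w : PseudoVal K, IsMacLane w → IsVal w → Below v w →
    s = discoid L w ∩ f.rootSet L → degree v < degree w

/-! The degree and the radius are well defined. -/

section Augmentation

variable {K : Type*} [Field K] {v w : PseudoVal K} {φ g : K[X]} {l : WithTop ℚ}

theorem IsAugmentation.apply_of_lt (h : IsAugmentation v φ l w) (hφ : φ.Monic)
    (hg : g.natDegree < φ.natDegree) : w g = v g := by
  have hd : g.degree < φ.degree := degree_lt_degree hg
  have h0 : g %ₘ φ = g := (modByMonic_eq_self_iff hφ).2 hd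
  rw [h g]
  apply le_antisymm
  · refine (Finset.inf_le (Finset.mem_range.2 (Nat.succ_pos _))).trans ?_
    simp [h0]
  · refine Finset.le_inf fun i _ => ?_
    rcases Nat.eq_zero_or_pos i with rfl | hi
    · simp [h0]
    · have : g /ₘ φ ^ i = 0 := by
        rw [divByMonic_eq_zero_iff (hφ.pow i)]
        refine degree_lt_degree (hg.trans_le ?_)
        rw [hφ.natDegree_pow]
        exact Nat.le_mul_of_pos_left _ hi
      simp [this]

theorem IsAugmentation.apply_le (h : IsAugmentation v φ l w) (hφ : φ.Monic)
    (hpos : 0 < φ.natDegree) (hg : g.Monic) (hd : g.natDegree = φ.natDegree) : w g ≤ l := by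
  have h1 : g /ₘ φ = 1 := by
    have hdeg : (g /ₘ φ).natDegree = 0 := by rw [natDegree_divByMonic _ hφ]; omega
    have hlc : (g /ₘ φ).leadingCoeff = 1 := by
      rw [leadingCoeff_divByMonic_of_monic hφ]
      · exact hg
      · exact (degree_le_degree (by
          have := hg.coeff_natDegree; rw [hd] at this; rw [this]; exact one_ne_zero))
    exact (show (g /ₘ φ).Monic from hlc).natDegree_eq_zero.1 hdeg
  have h2 : (1 : K[X]) %ₘ φ = 1 :=
    (modByMonic_eq_self_iff hφ).2 (degree_lt_degree (by simpa using hpos))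
  rw [h g]
  refine (Finset.inf_le (Finset.mem_range.2 (by omega : 1 < g.natDegree + 1))).trans ?_
  simp [h1, h2]

theorem IsAugmentation.apply_self (h : IsAugmentation v φ l w) (hφ : φ.Monic)
    (hpos : 0 < φ.natDegree) : w φ = l := by
  refine le_antisymm (h.apply_le hφ hpos hφ rfl) ?_
  have h2 : (1 : K[X]) %ₘ φ = 1 :=
    (modByMonic_eq_self_iff hφ).2 (degree_lt_degree (by simpa using hpos))
  rw [h φ]
  refine Finset.le_inf fun i _ => ?_
  rcases Nat.lt_trichotomy i 1 with hi | rfl | hi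
  · obtain rfl : i = 0 := by omega
    simp [(modByMonic_eq_zero_iff_dvd hφ).2 dvd_rfl]
  · have : φ /ₘ φ = 1 := by
      have := mul_divByMonic_cancel_left (1 : K[X]) hφ
      rwa [mul_one] at this
    simp [this, h2]
  · have : φ /ₘ φ ^ i = 0 := by
      rw [divByMonic_eq_zero_iff (hφ.pow i)]
      refine degree_lt_degree ?_
      rw [hφ.natDegree_pow]
      nlinarith
    simp [this]

theorem sum_expansion (hφ : φ.Monic) (g : K[X]) (n : ℕ) :
    g = ∑ i ∈ Finset.range n, ((g /ₘ φ ^ i) %ₘ φ) * φ ^ i + (g /ₘ φ ^ n) * φ ^ n := by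
  induction n with
  | zero => simp
  | succ n ih =>
    have h1 : g /ₘ φ ^ (n + 1) = (g /ₘ φ ^ n) /ₘ φ := by
      refine (div_modByMonic_unique (r := φ ^ n * ((g /ₘ φ ^ n) %ₘ φ) + g %ₘ φ ^ n) _
        (hφ.pow _) ⟨?_, ?_⟩).1
      · have e1 := modByMonic_add_div g (φ ^ n)
        have e2 := modByMonic_add_div (g /ₘ φ ^ n) φ
        calc _ = g %ₘ φ ^ n + φ ^ n * ((g /ₘ φ ^ n) %ₘ φ + φ * (g /ₘ φ ^ n /ₘ φ)) := by ring
          _ = g := by rw [e2, e1]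
      · have hn : (φ ^ n).degree ≤ (φ ^ (n + 1)).degree :=
          degree_le_of_dvd (pow_dvd_pow φ n.le_succ) (hφ.pow _).ne_zero
        refine (degree_add_le _ _).trans_lt (max_lt ?_ ?_)
        · rw [pow_succ, degree_mul, degree_mul]
          exact (WithBot.add_lt_add_iff_left (degree_ne_bot.2 (hφ.pow n).ne_zero)).2
            (degree_modByMonic_lt _ hφ)
        · exact (degree_modByMonic_lt _ (hφ.pow n)).trans_le hn
    conv_lhs => rw [ih]
    rw [Finset.sum_range_succ, h1, add_assoc]
    congr 1
    have := modByMonic_add_div (g /ₘ φ ^ n) φ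
    conv_lhs => rw [← this]
    ring

theorem le_apply_of_expansion (hφ : φ.Monic) (hpos : 0 < φ.natDegree) {c : WithTop ℚ}
    (h : ∀ i ∈ Finset.range (g.natDegree + 1), c ≤ v ((g /ₘ φ ^ i) %ₘ φ) + i • v φ) :
    c ≤ v g := by
  have h0 : g /ₘ φ ^ (g.natDegree + 1) = 0 := by
    rw [divByMonic_eq_zero_iff (hφ.pow _)]
    refine degree_lt_degree ?_
    rw [hφ.natDegree_pow]
    nlinarith
  rw [sum_expansion hφ g (g.natDegree + 1), h0, zero_mul, add_zero]
  refine AddValuation.map_le_sum v fun i hi => ?_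
  rw [AddValuation.map_mul, AddValuation.map_pow]
  exact h i hi

theorem IsAugmentation.natDegree_le {v' w : PseudoVal K} {φ' : K[X]} {l' : WithTop ℚ}
    (h : IsAugmentation v φ l w) (hφ : φ.Monic) (hpos : 0 < φ.natDegree) (hl : v φ < l)
    (h' : IsAugmentation v' φ' l' w) (hφ' : φ'.Monic) (hpos' : 0 < φ'.natDegree) :
    φ.natDegree ≤ φ'.natDegree := by
  by_contra! hlt
  refine absurd hl (not_lt.2 ?_)
  rw [← h.apply_self hφ hpos]
  refine le_apply_of_expansion hφ' hpos' fun i hi => ?_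
  have hai : ((φ /ₘ φ' ^ i) %ₘ φ').natDegree < φ'.natDegree :=
    natDegree_modByMonic_lt _ hφ' (by rintro rfl; simp at hpos')
  rw [← h.apply_of_lt hφ (hai.trans hlt), ← h.apply_of_lt hφ hlt, h'.apply_of_lt hφ' hai,
    h'.apply_self hφ' hpos', h' φ]
  exact Finset.inf_le (f := fun i => v' ((φ /ₘ φ' ^ i) %ₘ φ') + i • l') hi

end Augmentation

/-- MacLane pseudo-valuations extend `v_K` and are non-negative at `x`. -/
theorem HasCentreRadius.extends_vK {v : PseudoVal K} {φ : K[X]} {l : WithTop ℚ}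
    (h : HasCentreRadius v φ l) : (∀ c : K, v (C c) = vK K c) ∧ 0 ≤ v X := by
  induction h with
  | gauss v φ hv _ _ _ =>
    constructor
    · intro c
      rw [hv]
      by_cases hc : c = 0
      · simp [hc, vK]
      · rw [support_C hc]; simp
    · rw [hv, support_X]
      simp [vK]
  | augment v ψ m w φ l _ _ key lt aug ih =>
    have hC : ∀ c : K, w (C c) = vK K c := fun c => by
      rw [aug.apply_of_lt key.monic (by simpa using key.natDegree_pos), ih.1]
    refine ⟨hC, ?_⟩
    rcases Nat.lt_or_ge 1 φ.natDegree with hd | hd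
    · rw [aug.apply_of_lt key.monic (by simpa using hd)]
      exact ih.2
    · have hd1 : φ.natDegree = 1 := le_antisymm hd key.natDegree_pos
      obtain ⟨c, hφ⟩ : ∃ c, φ = X + C c :=
        ⟨φ.coeff 0, key.monic.eq_X_add_C hd1⟩
      have hwφ := aug.apply_self key.monic key.natDegree_pos
      have hc : 0 ≤ vK K c := by
        by_contra! hneg
        have hdiv : VDvd v φ (C c) := by
          refine ⟨1, ?_⟩
          have : (C c : K[X]) - 1 * φ = -X := by rw [hφ]; ring
          rw [this, AddValuation.map_neg, ih.1]
          exact hneg.trans_le ih.2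
        have := key.minimal _ hdiv
        rw [natDegree_C] at this
        omega
      have hvφ : 0 ≤ v φ := by
        rw [hφ]
        exact AddValuation.map_le_add v ih.2 (by rw [ih.1]; exact hc)
      have hX : (X : K[X]) = φ + C (-c) := by rw [hφ]; simp
      rw [hX]
      refine AddValuation.map_le_add w (by rw [hwφ]; exact hvφ.trans lt.le) ?_
      rw [C_neg, AddValuation.map_neg, hC]
      exact hc

theorem IsGauss.le_apply {v w : PseudoVal K} {φ : K[X]} {l : WithTop ℚ} (hw : IsGauss w)
    (h : HasCentreRadius v φ l) (g : K[X]) : w g ≤ v g := by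
  conv_rhs => rw [g.as_sum_support_C_mul_X_pow]
  refine AddValuation.map_le_sum v fun i hi => ?_
  rw [AddValuation.map_mul, AddValuation.map_pow, h.extends_vK.1, hw g]
  refine (Finset.inf_le hi).trans ?_
  exact le_add_of_nonneg_right (nsmul_nonneg h.extends_vK.2 i)

theorem HasCentreRadius.unique {v : PseudoVal K} {φ φ' : K[X]} {l l' : WithTop ℚ}
    (h : HasCentreRadius v φ l) (h' : HasCentreRadius v φ' l') :
    φ.natDegree = φ'.natDegree ∧ l = l' := by
  have key : ∀ {u w : PseudoVal K} {ψ χ : K[X]} {m k : WithTop ℚ}, IsGauss w → HasCentreRadius u ψ m → IsKeyPoly u χ → u χ < k →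
      IsAugmentation u χ k w → False := by
    intro u w ψ χ m k hw hu hχ hk ha
    have := hw.le_apply hu χ
    rw [ha.apply_self hχ.monic hχ.natDegree_pos] at this
    exact absurd hk (not_lt.2 this)
  cases h with
  | gauss _ _ hv _ hd _ =>
    cases h' with
    | gauss _ _ _ _ hd' _ => exact ⟨hd.trans hd'.symm, rfl⟩
    | augment _ _ _ _ _ _ hu _ hk lt aug => exact (key hv hu hk lt aug).elim
  | augment _ _ _ _ _ _ hu _ hk lt aug =>
    cases h' with
    | gauss _ _ hv _ _ _ => exact (key hv hu hk lt aug).elim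
    | augment _ _ _ _ _ _ hu' _ hk' lt' aug' =>
      have hd := le_antisymm
        (aug.natDegree_le hk.monic hk.natDegree_pos lt aug' hk'.monic hk'.natDegree_pos)
        (aug'.natDegree_le hk'.monic hk'.natDegree_pos lt' aug hk.monic hk.natDegree_pos)
      refine ⟨hd, le_antisymm ?_ ?_⟩
      · rw [← aug.apply_self hk.monic hk.natDegree_pos]
        exact aug'.apply_le hk'.monic hk'.natDegree_pos hk.monic hd
      · rw [← aug'.apply_self hk'.monic hk'.natDegree_pos]
        exact aug.apply_le hk.monic hk.natDegree_pos hk'.monic hd.symm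

theorem HasCentreRadius.degree_eq {v : PseudoVal K} {φ : K[X]} {l : WithTop ℚ}
    (h : HasCentreRadius v φ l) : degree v = φ.natDegree := by
  obtain ⟨ψ, m, h', hd⟩ :=
    Classical.epsilon_spec (p := fun d => ∃ φ l, HasCentreRadius v φ l ∧ φ.natDegree = d)
      ⟨_, φ, l, h, rfl⟩
  exact hd.symm.trans (h'.unique h).1

theorem HasCentreRadius.radius_eq {v : PseudoVal K} {φ : K[X]} {l : WithTop ℚ}
    (h : HasCentreRadius v φ l) : radius v = l := by
  obtain ⟨ψ, h'⟩ :=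
    Classical.epsilon_spec (p := fun l => ∃ φ, HasCentreRadius v φ l) ⟨l, φ, h⟩
  exact (h'.unique h).2

end

end MacLane

/-! Evaluation at a root, g ↦ v_K(g(α)), is a pseudo-valuation u_α extending v_K
(`exists_pseudoVal_aeval`), and α lies in D_v exactly when v ≤ u_α. The lemma thus becomes a
comparison of v with pseudo-valuations above it.

If some monic g with deg g ≤ deg v takes values > λ_v on all of s, then v(g) ≤ λ_v shows that v and
u_r differ at g for r in s. They agree in degrees below deg v, so g has least degree among the
polynomials separating them and is a key polynomial (`IsKeyPoly.of_minimal`). Augmenting v at g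
gives a strictly larger valuation of the same degree whose discoid still contains s
(`HasCentreRadius.exists_below`), so (s, v) is no cluster. Hence no such g exists for a cluster, and
the centre of v, which is irreducible, attains the maximum λ_v.

Conversely, going up from v without raising the degree raises the radius (`lt_radius_of_below`), so
the centre of a valuation w violating the cluster condition would beat the maximum.

Both directions need that key polynomials over v have degree at least deg v
(`HasCentreRadius.natDegree_le_of_isKeyPoly`). The first also needs MacLane's theorem that
augmentations are multiplicative (`IsKeyPoly.augFun_mul`), a form of Gauss's lemma. -/

namespace MacLane

noncomputable section

/-! ### The extension of v_K to algebraic extensions, via the spectral norm -/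

/-- The absolute value `2 ^ (-q)` attached to an additive value `q`. -/
def absOfVal (a : WithTop ℚ) : ℝ := a.recTopCoe 0 fun q => (2 : ℝ) ^ (-(q : ℝ))

@[simp] theorem absOfVal_top : absOfVal ⊤ = 0 := rfl

@[simp] theorem absOfVal_coe (q : ℚ) : absOfVal q = (2 : ℝ) ^ (-(q : ℝ)) := rfl

theorem absOfVal_strictAnti : StrictAnti absOfVal := by
  intro a b hab
  induction a with
  | top => simp at hab
  | coe a =>
    induction b with
    | top => simpa using Real.rpow_pos_of_pos two_pos _
    | coe b =>
      rw [absOfVal_coe, absOfVal_coe, Real.rpow_lt_rpow_left_iff one_lt_two, neg_lt_neg_iff]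
      exact_mod_cast WithTop.coe_lt_coe.1 hab

theorem absOfVal_add (a b : WithTop ℚ) : absOfVal (a + b) = absOfVal a * absOfVal b := by
  induction a with
  | top => simp
  | coe a =>
    induction b with
    | top => simp
    | coe b =>
      rw [← WithTop.coe_add, absOfVal_coe, absOfVal_coe, absOfVal_coe, ← Real.rpow_add two_pos]
      push_cast
      ring_nf

/-- A real-valued nonarchimedean absolute value of the form `2 ^ (-u)` comes from an additive
valuation `u`. -/
def addValuationOfAbs {R : Type*} [Ring R] (u : R → WithTop ℚ) (h0 : absOfVal (u 0) = 0)
    (h1 : absOfVal (u 1) = 1)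
    (hmul : ∀ x y, absOfVal (u (x * y)) = absOfVal (u x) * absOfVal (u y))
    (hadd : ∀ x y, absOfVal (u (x + y)) ≤ max (absOfVal (u x)) (absOfVal (u y))) :
    AddValuation R (WithTop ℚ) :=
  AddValuation.of u
    (absOfVal_strictAnti.injective (by simpa using h0))
    (absOfVal_strictAnti.injective (by
      rw [h1, ← WithTop.coe_zero, absOfVal_coe]; simp))
    (fun x y => by
      rw [← absOfVal_strictAnti.le_iff_ge, absOfVal_strictAnti.antitone.map_min]
      exact hadd x y)
    (fun x y => absOfVal_strictAnti.injective (by rw [hmul, absOfVal_add]))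

section Extension

variable (K : Type*) [Field K] [Valued K ℤᵐ⁰]

theorem vK_ne_top {c : K} (hc : c ≠ 0) : vK K c ≠ ⊤ := by simp [vK, hc]

theorem absOfVal_vK (c : K) :
    absOfVal (vK K c) =
      (WithZeroMulInt.toNNReal (e := 2) two_ne_zero (Valued.v c : ℤᵐ⁰) : ℝ) := by
  by_cases hc : c = 0
  · simp [hc, vK]
  · have hv : (Valued.v c : ℤᵐ⁰) ≠ 0 := (Valuation.ne_zero_iff _).2 hc
    rw [vK, if_neg hc, absOfVal_coe, ← WithZero.exp_log hv, WithZero.log_exp,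
      WithZeroMulInt.toNNReal_neg_apply _ WithZero.exp_ne_zero]
    push_cast
    rw [neg_neg, Real.rpow_intCast]
    rfl

variable {K} in
theorem vKbar_algebraMap {L : Type*} [Field L] [Algebra K L] (c : K) :
    vKbar K (algebraMap K L c) = vK K c := by
  have h : vK K (-c) = vK K c := by
    by_cases hc : c = 0 <;> simp [vK, hc, Valuation.map_neg]
  rw [vKbar, minpoly.eq_X_sub_C L c, natDegree_X_sub_C]
  simp only [coeff_sub, coeff_X_zero, coeff_C_zero, zero_sub, h, Nat.cast_one, div_one]
  exact congrFun WithTop.map_id _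

/-- The rank one structure on the valuation of `K` given by `|c| = 2 ^ (-v_K(c))`. -/
@[reducible]
def rankOneOfSurjective (hK : Function.Surjective (Valued.v : K → ℤᵐ⁰)) :
    Valuation.RankOne (Valued.v : Valuation K ℤᵐ⁰) where
  hom' := (WithZeroMulInt.toNNReal (e := 2) two_ne_zero).comp
    MonoidWithZeroHom.ValueGroup₀.embedding
  strictMono' := (WithZeroMulInt.toNNReal_strictMono one_lt_two).comp
    MonoidWithZeroHom.ValueGroup₀.embedding_strictMono
  exists_val_nontrivial := by
    obtain ⟨x, hx⟩ := hK (WithZero.exp 1)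
    refine ⟨x, ?_, ?_⟩
    · rw [hx]; exact WithZero.exp_ne_zero
    · rw [hx]; simp

variable [CompleteSpace K] {L : Type*} [Field L] [Algebra K L] [Algebra.IsAlgebraic K L]


/-- The extension of `v_K` to an algebraic extension of a complete discretely valued field is an
additive valuation. -/
theorem exists_addValuation_vKbar (hK : Function.Surjective (Valued.v : K → ℤᵐ⁰)) :
    ∃ u : AddValuation L (WithTop ℚ), ∀ α, u α = vKbar K α := by
  let := rankOneOfSurjective K hK
  let : NontriviallyNormedField K :=
    { Valued.toNormedField K ℤᵐ⁰ with
      non_trivial := by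
        obtain ⟨x, hx⟩ := hK (WithZero.exp 1)
        refine ⟨x, (Valued.toNormedField.one_lt_norm_iff (L := K)).2 ?_⟩
        rw [hx, ← WithZero.exp_zero, WithZero.exp_lt_exp]
        exact one_pos }
  have : IsUltrametricDist K := inferInstanceAs (@IsUltrametricDist K
    (Valued.toNormedField K ℤᵐ⁰).toMetricSpace.toPseudoMetricSpace.toDist)
  have hnorm : ∀ c : K, ‖c‖ = absOfVal (vK K c) := fun c => by
    rw [absOfVal_vK]
    change ((WithZeroMulInt.toNNReal (e := 2) two_ne_zero
      (MonoidWithZeroHom.ValueGroup₀.embedding (Valued.v.restrict c)) : NNReal) : ℝ) = _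
    rw [Valuation.embedding_restrict]
  -- The spectral norm of α is |a₀|^(1/d), with a₀ the constant coefficient and d the degree of the
  -- minimal polynomial. This is `vKbar` written multiplicatively, so its valuation axioms are those
  -- of the spectral norm.
  have hN : ∀ α : L, spectralMulAlgNorm K L α = absOfVal (vKbar K α) := fun α => by
    rw [spectralMulAlgNorm_def, spectralNorm.spectralNorm_eq_norm_coeff_zero_rpow, hnorm, vKbar]
    have hd : ((minpoly K α).natDegree : ℝ) ≠ 0 := by
      exact_mod_cast (minpoly.natDegree_pos (Algebra.IsIntegral.isIntegral α)).ne'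
    induction vK K ((minpoly K α).coeff 0) with
    | top => simp [Real.zero_rpow (inv_ne_zero hd)]
    | coe q =>
      rw [WithTop.map_coe, absOfVal_coe, absOfVal_coe, ← Real.rpow_mul two_pos.le]
      push_cast
      ring_nf
  refine ⟨addValuationOfAbs (vKbar K) ?_ ?_ ?_ ?_, fun _ => rfl⟩
  · rw [← hN, map_zero]
  · rw [← hN, map_one]
  · intro x y
    simp only [← hN, map_mul]
  · intro x y
    simp only [← hN, spectralMulAlgNorm_def]
    exact isNonarchimedean_spectralNorm x y

end Extension

/-! ### φ-adic expansions -/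

section Expansion

variable {K : Type*} [Field K] {φ : K[X]}

theorem divByMonic_pow_succ (hφ : φ.Monic) (g : K[X]) (n : ℕ) :
    g /ₘ φ ^ (n + 1) = (g /ₘ φ) /ₘ φ ^ n := by
  refine (div_modByMonic_unique (r := g %ₘ φ + φ * ((g /ₘ φ) %ₘ φ ^ n)) _
    (hφ.pow _) ⟨?_, ?_⟩).1
  · have e1 := modByMonic_add_div g φ
    have e2 := modByMonic_add_div (g /ₘ φ) (φ ^ n)
    calc _ = g %ₘ φ + φ * ((g /ₘ φ) %ₘ φ ^ n + φ ^ n * (g /ₘ φ /ₘ φ ^ n)) := by ring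
      _ = g := by rw [e2, e1]
  · refine (degree_add_le _ _).trans_lt (max_lt ?_ ?_)
    · exact (degree_modByMonic_lt _ hφ).trans_le
        (degree_le_of_dvd (dvd_pow_self φ n.succ_ne_zero) (hφ.pow _).ne_zero)
    · rw [pow_succ', degree_mul, degree_mul]
      exact (WithBot.add_lt_add_iff_left (degree_ne_bot.2 hφ.ne_zero)).2
        (degree_modByMonic_lt _ (hφ.pow n))

theorem add_mul_divByMonic (hφ : φ.Monic) {a : K[X]} (ha : a.natDegree < φ.natDegree) (q : K[X]) :
    (a + φ * q) /ₘ φ = q :=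
  (div_modByMonic_unique _ _ hφ ⟨rfl, degree_lt_degree ha⟩).1

theorem add_mul_modByMonic (hφ : φ.Monic) {a : K[X]} (ha : a.natDegree < φ.natDegree) (q : K[X]) :
    (a + φ * q) %ₘ φ = a :=
  (div_modByMonic_unique _ _ hφ ⟨rfl, degree_lt_degree ha⟩).2

theorem natDegree_modByMonic_lt_of_pos (hφ : φ.Monic) (hpos : 0 < φ.natDegree) (g : K[X]) :
    (g %ₘ φ).natDegree < φ.natDegree :=
  natDegree_modByMonic_lt _ hφ (by rintro rfl; simp at hpos)

/-- Induction along the `φ`-adic expansion. -/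
theorem expansion_induction (hφ : φ.Monic) (hpos : 0 < φ.natDegree) {P : K[X] → Prop} (h0 : P 0)
    (h : ∀ a q : K[X], a.natDegree < φ.natDegree → P q → P (a + φ * q)) (g : K[X]) : P g := by
  induction hn : g.natDegree using Nat.strong_induction_on generalizing g with
  | _ n ih =>
    rcases lt_or_ge g.natDegree φ.natDegree with hg | hg
    · simpa using h g 0 hg h0
    · rw [← modByMonic_add_div g φ]
      refine h _ _ (natDegree_modByMonic_lt_of_pos hφ hpos g) (ih _ ?_ _ rfl)
      rw [natDegree_divByMonic _ hφ]
      omega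

end Expansion

/-! ### The augmentation as a function, without multiplicativity -/

section AugmentationFunction

variable {K : Type*} [Field K]

/-- The function underlying the augmentation `[v, w(φ) = l]`. -/
def augFun (v : PseudoVal K) (φ : K[X]) (l : WithTop ℚ) (g : K[X]) : WithTop ℚ :=
  (Finset.range (g.natDegree + 1)).inf fun i => v ((g /ₘ φ ^ i) %ₘ φ) + i • l

variable {v : PseudoVal K} {φ : K[X]} {l : WithTop ℚ}

theorem augFun_eq_inf_range (hφ : φ.Monic) (hpos : 0 < φ.natDegree) (g : K[X]) {N : ℕ}
    (hN : g.natDegree < N) :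
    augFun v φ l g = (Finset.range N).inf fun i => v ((g /ₘ φ ^ i) %ₘ φ) + i • l := by
  refine le_antisymm (Finset.le_inf fun i _ => ?_)
    (Finset.inf_mono (Finset.range_subset_range.2 hN))
  rcases lt_or_ge i (g.natDegree + 1) with hi | hi
  · exact Finset.inf_le (Finset.mem_range.2 hi)
  · have : g /ₘ φ ^ i = 0 := by
      rw [divByMonic_eq_zero_iff (hφ.pow i)]
      refine degree_lt_degree ?_
      rw [hφ.natDegree_pow]
      nlinarith
    simp [this]

theorem inf_range_succ (F : ℕ → WithTop ℚ) (N : ℕ) :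
    (Finset.range (N + 1)).inf F = min (F 0) ((Finset.range N).inf fun i => F (i + 1)) := by
  rw [Finset.range_add_one', Finset.inf_insert, Finset.inf_map]
  rfl

/-- Splitting off the lowest digit gives a Horner-type recursion, which lets the later arguments run
by induction on the expansion instead of manipulating minima over index ranges. -/
theorem augFun_eq_min (hφ : φ.Monic) (hpos : 0 < φ.natDegree) (g : K[X]) :
    augFun v φ l g = min (v (g %ₘ φ)) (l + augFun v φ l (g /ₘ φ)) := by
  have hN : (g /ₘ φ).natDegree < g.natDegree + 1 := by
    rw [natDegree_divByMonic _ hφ]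
    omega
  rw [augFun_eq_inf_range hφ hpos g (N := g.natDegree + 1 + 1) (by omega),
    augFun_eq_inf_range hφ hpos (g /ₘ φ) hN, inf_range_succ _ (g.natDegree + 1),
    Finset.apply_inf_eq_inf_comp_of_linearOrder (g := fun x => l + x)
      (fun x y hxy => add_le_add_right hxy l) (by simp)]
  simp only [Function.comp_def, pow_zero, divByMonic_one, zero_smul, add_zero,
    divByMonic_pow_succ hφ, succ_nsmul']
  congr 2
  ext i
  exact add_left_comm _ _ _

theorem augFun_zero : augFun v φ l 0 = ⊤ := by simp [augFun]

theorem augFun_add_mul (hφ : φ.Monic) {a : K[X]} (ha : a.natDegree < φ.natDegree) (q : K[X]) :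
    augFun v φ l (a + φ * q) = min (v a) (l + augFun v φ l q) := by
  rw [augFun_eq_min hφ (Nat.zero_lt_of_lt ha), add_mul_divByMonic hφ ha, add_mul_modByMonic hφ ha]

theorem augFun_of_lt (hφ : φ.Monic) {a : K[X]} (ha : a.natDegree < φ.natDegree) :
    augFun v φ l a = v a := by
  have := augFun_add_mul (v := v) (l := l) hφ ha 0
  simpa [augFun_zero] using this

theorem augFun_self_mul (hφ : φ.Monic) (hpos : 0 < φ.natDegree) (q : K[X]) :
    augFun v φ l (φ * q) = l + augFun v φ l q := by
  have := augFun_add_mul (v := v) (l := l) hφ (a := 0) (by simpa using hpos) q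
  simpa using this

theorem augFun_pow_mul (hφ : φ.Monic) (hpos : 0 < φ.natDegree) (n : ℕ) (q : K[X]) :
    augFun v φ l (φ ^ n * q) = n • l + augFun v φ l q := by
  induction n with
  | zero => simp
  | succ n ih => rw [pow_succ', mul_assoc, augFun_self_mul hφ hpos, ih, succ_nsmul', add_assoc]

theorem le_augFun_add (hφ : φ.Monic) (hpos : 0 < φ.natDegree) (g h : K[X]) :
    min (augFun v φ l g) (augFun v φ l h) ≤ augFun v φ l (g + h) := by
  induction g using expansion_induction hφ hpos generalizing h with
  | h0 => simp
  | h a q ha ih =>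
    have hb := natDegree_modByMonic_lt_of_pos hφ hpos h
    have hsum : a + φ * q + h = (a + h %ₘ φ) + φ * (q + h /ₘ φ) := by
      conv_lhs => rw [← modByMonic_add_div h φ]
      ring
    rw [hsum, augFun_eq_min hφ hpos h, augFun_add_mul hφ ha,
      augFun_add_mul hφ ((natDegree_add_le _ _).trans_lt (max_lt ha hb))]
    refine le_min ?_ ?_
    · refine le_trans (le_min ?_ ?_) (AddValuation.map_add v a (h %ₘ φ))
      · exact (min_le_left _ _).trans (min_le_left _ _)
      · exact (min_le_right _ _).trans (min_le_left _ _)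
    · refine le_trans ?_ (add_le_add_right (ih (h /ₘ φ)) l)
      rw [← min_add_add_left]
      exact min_le_min (min_le_right _ _) (min_le_right _ _)

theorem augFun_eq_top_iff (hφ : φ.Monic) (hpos : 0 < φ.natDegree) (hv : IsVal v) (hl : l ≠ ⊤)
    (g : K[X]) : augFun v φ l g = ⊤ ↔ g = 0 := by
  refine ⟨fun h => ?_, fun h => h ▸ augFun_zero⟩
  induction g using expansion_induction hφ hpos with
  | h0 => rfl
  | h a q ha ih =>
    rw [augFun_add_mul hφ ha, min_eq_top, WithTop.add_eq_top] at h
    rw [(hv a).1 h.1, ih (h.2.resolve_left hl)]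
    simp

end AugmentationFunction

/-! ### Key polynomials and MacLane's theorem on augmentations -/

section KeyPolynomial

variable {K : Type*} [Field K] {v : PseudoVal K} {φ : K[X]} {l : WithTop ℚ}

theorem VDvd.of_dvd {h g : K[X]} (hg : v g ≠ ⊤) (hd : h ∣ g) : VDvd v h g := by
  obtain ⟨q, rfl⟩ := hd
  exact ⟨q, by simpa [mul_comm] using lt_top_iff_ne_top.2 hg⟩

theorem IsKeyPoly.not_vDvd (hφ : IsKeyPoly v φ) {a : K[X]} (ha : a.natDegree < φ.natDegree) :
    ¬ VDvd v φ a :=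
  fun h => absurd (hφ.minimal a h) (not_le.2 ha)

theorem IsKeyPoly.not_vDvd_mul (hφ : IsKeyPoly v φ) {a b : K[X]}
    (ha : a.natDegree < φ.natDegree) (hb : b.natDegree < φ.natDegree) : ¬ VDvd v φ (a * b) :=
  fun h => (hφ.irreducible a b h).elim (hφ.not_vDvd ha) (hφ.not_vDvd hb)

theorem apply_sub_mul_le_of_not_vDvd {g : K[X]} (h : ¬ VDvd v φ g) (q : K[X]) :
    v (g - q * φ) ≤ v g :=
  not_lt.1 fun hlt => h ⟨q, hlt⟩

/-- Since φ does not v-divide a, no multiple of φ can cancel the value of a. This is the recursion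
of `augFun_add_mul` at l = v φ, so v is itself computed from φ-adic expansions. -/
theorem IsKeyPoly.apply_add_mul (hφ : IsKeyPoly v φ) {a : K[X]}
    (ha : a.natDegree < φ.natDegree) (q : K[X]) : v (a + φ * q) = min (v a) (v φ + v q) := by
  have h1 : v (a + φ * q) ≤ v a := by
    have := apply_sub_mul_le_of_not_vDvd (hφ.not_vDvd ha) (-q)
    rwa [neg_mul, sub_neg_eq_add, mul_comm q] at this
  rw [← AddValuation.map_mul]
  refine le_antisymm (le_min h1 ?_) (AddValuation.map_add _ _ _)
  have h2 := AddValuation.map_sub v (a + φ * q) a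
  rwa [min_eq_left h1, add_sub_cancel_left] at h2

/-- By v-irreducibility and v-minimality φ does not v-divide ab, so reduction modulo φ cannot raise
the value; by `IsKeyPoly.apply_add_mul` it cannot lower it. -/
theorem IsKeyPoly.apply_mul_modByMonic (hφ : IsKeyPoly v φ) {a b : K[X]}
    (ha : a.natDegree < φ.natDegree) (hb : b.natDegree < φ.natDegree) :
    v ((a * b) %ₘ φ) = v a + v b := by
  rw [← AddValuation.map_mul]
  have hr := natDegree_modByMonic_lt_of_pos hφ.monic hφ.natDegree_pos (a * b)
  apply le_antisymm
  · have := apply_sub_mul_le_of_not_vDvd (hφ.not_vDvd_mul ha hb) ((a * b) /ₘ φ)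
    rwa [mul_comm _ φ, ← modByMonic_eq_sub_mul_div] at this
  · conv_lhs => rw [← modByMonic_add_div (a * b) φ]
    rw [hφ.apply_add_mul hr]
    exact min_le_left _ _

theorem IsKeyPoly.le_augFun (hφ : IsKeyPoly v φ) (hl : v φ ≤ l) (g : K[X]) :
    v g ≤ augFun v φ l g := by
  induction g using expansion_induction hφ.monic hφ.natDegree_pos with
  | h0 => simp [augFun_zero]
  | h a q ha ih =>
    rw [augFun_add_mul hφ.monic ha, hφ.apply_add_mul ha]
    exact min_le_min le_rfl (add_le_add hl ih)

theorem IsKeyPoly.augFun_add_le_augFun_mul (hφ : IsKeyPoly v φ) (hl : v φ ≤ l) (f g : K[X]) :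
    augFun v φ l f + augFun v φ l g ≤ augFun v φ l (f * g) := by
  -- A product of two digits need not be reduced modulo φ; `IsKeyPoly.le_augFun` bounds its
  -- augmented value below by its v-value.
  have key : ∀ a : K[X], a.natDegree < φ.natDegree → ∀ g : K[X],
      v a + augFun v φ l g ≤ augFun v φ l (a * g) := by
    intro a ha g
    induction g using expansion_induction hφ.monic hφ.natDegree_pos with
    | h0 => simp [augFun_zero]
    | h b q hb ih =>
      rw [augFun_add_mul hφ.monic hb, mul_add, mul_left_comm]
      refine le_trans (le_min ?_ ?_) (le_augFun_add hφ.monic hφ.natDegree_pos _ _)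
      · refine le_trans ?_ (hφ.le_augFun hl _)
        rw [AddValuation.map_mul]
        exact add_le_add_right (min_le_left _ _) _
      · rw [augFun_self_mul hφ.monic hφ.natDegree_pos]
        refine le_trans ?_ (add_le_add_right ih l)
        rw [add_left_comm]
        exact add_le_add_right (min_le_right _ _) _
  induction f using expansion_induction hφ.monic hφ.natDegree_pos with
  | h0 => simp [augFun_zero]
  | h a q ha ih =>
    rw [augFun_add_mul hφ.monic ha, add_mul, mul_assoc]
    refine le_trans (le_min ?_ ?_) (le_augFun_add hφ.monic hφ.natDegree_pos _ _)
    · exact (add_le_add_left (min_le_left _ _) _).trans (key a ha g)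
    · rw [augFun_self_mul hφ.monic hφ.natDegree_pos]
      refine le_trans ?_ (add_le_add_right ih l)
      rw [← add_assoc]
      exact add_le_add_left (min_le_right _ _) _

/-- Splitting off the terms of the `φ`-adic expansion below the first one of minimal value. -/
theorem exists_initial_term (hφ : φ.Monic) (hpos : 0 < φ.natDegree) (hl : l ≠ ⊤) (g : K[X])
    (hg : augFun v φ l g ≠ ⊤) :
    ∃ (n : ℕ) (lo hi : K[X]), g = lo + φ ^ n * hi ∧ augFun v φ l g < augFun v φ l lo ∧
      augFun v φ l g = n • l + v (hi %ₘ φ) := by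
  induction g using expansion_induction hφ hpos with
  | h0 => exact absurd augFun_zero hg
  | h a q ha ih =>
    have hmin := augFun_add_mul (v := v) (l := l) hφ ha q
    rcases le_or_gt (v a) (l + augFun v φ l q) with hle | hlt
    · refine ⟨0, 0, a + φ * q, by simp, by simpa [augFun_zero] using lt_top_iff_ne_top.2 hg, ?_⟩
      rw [add_mul_modByMonic hφ ha, hmin, min_eq_left hle]
      simp
    · rw [min_eq_right hlt.le] at hmin
      obtain ⟨n, lo, hi, hq, hlo, hval⟩ := ih fun h => hg (by rw [hmin, h, add_top])
      refine ⟨n + 1, a + φ * lo, hi, ?_, ?_, ?_⟩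
      · conv_lhs => rw [hq]
        ring
      · rw [hmin, augFun_add_mul hφ ha]
        exact lt_min hlt (WithTop.add_lt_add_left hl hlo)
      · rw [hmin, hval, succ_nsmul', add_assoc]

/-- As in Gauss's lemma, the product of the first digits of minimal value survives: modulo φ it
keeps the sum of their values, by `IsKeyPoly.apply_mul_modByMonic`. -/
theorem IsKeyPoly.augFun_mul (hφ : IsKeyPoly v φ) (hl : v φ ≤ l) (htop : l ≠ ⊤) (f g : K[X]) :
    augFun v φ l (f * g) = augFun v φ l f + augFun v φ l g := by
  have hm := hφ.monic
  have hpos := hφ.natDegree_pos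
  refine le_antisymm ?_ (hφ.augFun_add_le_augFun_mul hl f g)
  by_cases hf : augFun v φ l f = ⊤
  · simp [hf]
  by_cases hg : augFun v φ l g = ⊤
  · simp [hg]
  by_contra! hlt
  obtain ⟨n, lo, hi, hfe, hlo, hval⟩ := exists_initial_term hm hpos htop f hf
  obtain ⟨m, lo', hi', hge, hlo', hval'⟩ := exists_initial_term hm hpos htop g hg
  have hneg : ∀ h : K[X], augFun v φ l h ≤ augFun v φ l (-h) := fun h => by
    have h1 : augFun v φ l (-1) = 0 := by
      rw [augFun_of_lt hm (by simpa using hpos), AddValuation.map_neg, AddValuation.map_one]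
    have := hφ.augFun_add_le_augFun_mul hl (-1) h
    rwa [h1, zero_add, neg_one_mul] at this
  have hhi : n • l + v (hi %ₘ φ) ≤ augFun v φ l (φ ^ n * hi) := by
    rw [← hval]
    have : φ ^ n * hi = f + -lo := by rw [hfe]; ring
    rw [this]
    exact (le_min le_rfl (hlo.le.trans (hneg lo))).trans (le_augFun_add hm hpos _ _)
  -- If fg had too large a value, every term on the right would, hence also the left side, whose
  -- lowest digit gives the contradiction.
  have hexp : φ ^ (n + m) * (hi * hi') = f * g + -(lo * g + φ ^ n * hi * lo') := by
    conv_rhs => rw [hfe, hge]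
    ring
  have hlow : augFun v φ l f + augFun v φ l g < augFun v φ l (φ ^ (n + m) * (hi * hi')) := by
    rw [hexp]
    refine lt_of_lt_of_le (lt_min hlt ?_) (le_augFun_add hm hpos _ _)
    refine lt_of_lt_of_le ?_ (hneg _)
    refine lt_of_lt_of_le (lt_min ?_ ?_) (le_augFun_add hm hpos _ _)
    · exact (WithTop.add_lt_add_right hg hlo).trans_le (hφ.augFun_add_le_augFun_mul hl _ _)
    · refine lt_of_lt_of_le ?_ (hφ.augFun_add_le_augFun_mul hl _ _)
      exact (WithTop.add_lt_add_left hf hlo').trans_le (add_le_add_left (hval.trans_le hhi) _)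
  refine absurd hlow (not_lt.2 ?_)
  have hr := natDegree_modByMonic_lt_of_pos hm hpos
  rw [augFun_pow_mul hm hpos, augFun_eq_min hm hpos, mul_modByMonic,
    hφ.apply_mul_modByMonic (hr hi) (hr hi'), hval, hval', add_nsmul]
  refine (add_le_add_right (min_le_left _ _) _).trans_eq ?_
  exact add_add_add_comm _ _ _ _

/-- MacLane's theorem: augmentations with respect to key polynomials are pseudo-valuations. -/
theorem IsKeyPoly.exists_isAugmentation (hφ : IsKeyPoly v φ) (hl : v φ ≤ l) (htop : l ≠ ⊤) :
    ∃ w : PseudoVal K, IsAugmentation v φ l w :=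
  ⟨AddValuation.of (augFun v φ l) augFun_zero
    (by rw [augFun_of_lt hφ.monic (by simpa using hφ.natDegree_pos), AddValuation.map_one])
    (le_augFun_add hφ.monic hφ.natDegree_pos) (hφ.augFun_mul hl htop), fun _ => rfl⟩

theorem IsAugmentation.isVal {w : PseudoVal K} (h : IsAugmentation v φ l w) (hφ : φ.Monic)
    (hpos : 0 < φ.natDegree) (hv : IsVal v) (hl : l ≠ ⊤) : IsVal w := fun g => by
  rw [h g]
  exact augFun_eq_top_iff hφ hpos hv hl g

theorem IsAugmentation.le_apply {w : PseudoVal K} (h : IsAugmentation v φ l w)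
    (hφ : IsKeyPoly v φ) (hl : v φ ≤ l) (g : K[X]) : v g ≤ w g := by
  rw [h g]
  exact hφ.le_augFun hl g

/-- Augmentations are minimal among the pseudo-valuations `u ≥ v` with `u φ ≥ l`. -/
theorem IsAugmentation.apply_le_of_le {u w : PseudoVal K} (h : IsAugmentation v φ l w)
    (hφ : φ.Monic) (hpos : 0 < φ.natDegree)
    (hu : ∀ a : K[X], a.natDegree < φ.natDegree → v a ≤ u a) (hl : l ≤ u φ) (g : K[X]) :
    w g ≤ u g := by
  refine le_apply_of_expansion hφ hpos fun i hi => ?_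
  rw [h g]
  exact (Finset.inf_le hi).trans (add_le_add
    (hu _ (natDegree_modByMonic_lt_of_pos hφ hpos _)) (nsmul_le_nsmul_right hl i))

/-- As v φ is finite, φ v-divides any factorisation ab = φ, hence one of the factors, which by
v-minimality then has full degree. -/
theorem IsKeyPoly.irreducible_of_isVal (hφ : IsKeyPoly v φ) (hv : IsVal v) : Irreducible φ := by
  have h0 : φ ≠ 0 := hφ.monic.ne_zero
  rw [Polynomial.Monic.irreducible_iff_natDegree hφ.monic]
  refine ⟨fun h1 => by simpa [h1] using hφ.natDegree_pos, fun a b ha hb hab => ?_⟩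
  have hdeg : φ.natDegree = a.natDegree + b.natDegree := by
    rw [← hab, ha.natDegree_mul hb]
  have hdvd : VDvd v φ (a * b) := VDvd.of_dvd (by rwa [hab, Ne, hv]) hab.symm.dvd
  rcases hφ.irreducible a b hdvd with h | h
  · have := hφ.minimal a h
    omega
  · have := hφ.minimal b h
    omega

/-- A polynomial of least degree among those with `v g < u g` is a key polynomial. -/
theorem IsKeyPoly.of_minimal {u : PseudoVal K} {g : K[X]} (hvu : ∀ a : K[X], v a ≤ u a)
    (hg : g.Monic) (hpos : 0 < g.natDegree) (hlt : v g < u g)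
    (hmin : ∀ a : K[X], v a < u a → g.natDegree ≤ a.natDegree) : IsKeyPoly v g := by
  -- The condition v a < u a is prime because u and v are multiplicative with v ≤ u, and g has least
  -- degree for it by choice.
  have key : ∀ a : K[X], VDvd v g a ↔ v a < u a := by
    refine fun a => ⟨fun ⟨q, hq⟩ => ?_, fun ha => ⟨a /ₘ g, ?_⟩⟩
    · have hqg : v (q * g) = v a := by
        have : q * g = a - (a - q * g) := by ring
        rw [this]
        exact AddValuation.map_sub_eq_of_lt_left v hq
      have hqt : v q ≠ ⊤ := fun h => by
        rw [AddValuation.map_mul, h, top_add] at hqg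
        exact not_top_lt (hqg ▸ hq)
      have h1 : v a < u (q * g) := by
        rw [← hqg, AddValuation.map_mul, AddValuation.map_mul]
        exact (WithTop.add_lt_add_left hqt hlt).trans_le (add_le_add_left (hvu q) _)
      have h2 := AddValuation.map_add u (a - q * g) (q * g)
      rw [sub_add_cancel] at h2
      exact (lt_min (hq.trans_le (hvu _)) h1).trans_le h2
    · rw [mul_comm, ← modByMonic_eq_sub_mul_div]
      -- Were the remainder of value at most v a, both a and the multiple of g would have larger
      -- u-value than it, so u and v would differ at a polynomial of degree below deg g.
      by_contra! hle
      have hr : u (a %ₘ g) = v (a %ₘ g) := by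
        refine le_antisymm (not_lt.1 fun h => ?_) (hvu _)
        exact absurd (hmin _ h) (not_le.2 (natDegree_modByMonic_lt_of_pos hg hpos a))
      have hrt : v (a %ₘ g) ≠ ⊤ := (hle.trans_lt (ha.trans_le le_top)).ne
      have he : g * (a /ₘ g) = a - a %ₘ g := by rw [modByMonic_eq_sub_mul_div]; ring
      have h1 : v (a %ₘ g) ≤ v (g * (a /ₘ g)) := by
        rw [he]
        exact (le_min hle le_rfl).trans (AddValuation.map_sub _ _ _)
      have h2 : v (a %ₘ g) < u (g * (a /ₘ g)) := by
        -- A pseudo-valuation may be infinite at a nonzero quotient, where strict inequalities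
        -- cannot be translated.
        by_cases hq : v (a /ₘ g) = ⊤
        · rw [AddValuation.map_mul, top_le_iff.1 (hq.symm.trans_le (hvu (a /ₘ g))), add_top]
          exact lt_top_iff_ne_top.2 hrt
        · refine h1.trans_lt ?_
          rw [AddValuation.map_mul, AddValuation.map_mul]
          exact (WithTop.add_lt_add_right hq hlt).trans_le (add_le_add_right (hvu _) _)
      have h3 : v (a %ₘ g) < u (a %ₘ g) := by
        conv_rhs => rw [modByMonic_eq_sub_mul_div]
        exact (lt_min (hle.trans_lt ha) h2).trans_le (AddValuation.map_sub _ _ _)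
      exact absurd hr h3.ne'
  refine ⟨hg, hpos, fun a b hab => ?_, fun a ha => hmin a ((key a).1 ha)⟩
  rw [key, AddValuation.map_mul, AddValuation.map_mul] at hab
  rw [key, key]
  by_contra! h
  exact absurd hab (not_lt.2 (add_le_add h.1 h.2))

end KeyPolynomial

/-! ### Degree and radius under the order on pseudo-valuations -/

section Radius

variable {K : Type*} [Field K] [Valued K ℤᵐ⁰]

theorem vK_one : vK K (1 : K) = 0 := by simp [vK]

theorem IsGauss.isVal {v : PseudoVal K} (hv : IsGauss v) : IsVal v := fun g => by
  refine ⟨fun h => ?_, fun h => by simp [h]⟩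
  rw [hv g, Finset.inf_eq_top_iff] at h
  by_contra hg
  have hn : g.natDegree ∈ g.support := natDegree_mem_support_of_nonzero hg
  exact vK_ne_top K (mem_support_iff.1 hn) (h _ hn)

theorem IsGauss.apply_le_zero {v : PseudoVal K} (hv : IsGauss v) {g : K[X]} (hg : g.Monic) :
    v g ≤ 0 := by
  rw [hv g]
  refine (Finset.inf_le (natDegree_mem_support_of_nonzero hg.ne_zero)).trans ?_
  rw [hg.coeff_natDegree, vK_one]

namespace HasCentreRadius

variable {v : PseudoVal K} {φ : K[X]} {l : WithTop ℚ}

theorem monic (h : HasCentreRadius v φ l) : φ.Monic := by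
  cases h with
  | gauss _ _ _ monic _ _ => exact monic
  | augment _ _ _ _ _ _ _ _ key _ _ => exact key.monic

theorem natDegree_pos (h : HasCentreRadius v φ l) : 0 < φ.natDegree := by
  cases h with
  | gauss _ _ _ _ hd _ => omega
  | augment _ _ _ _ _ _ _ _ key _ _ => exact key.natDegree_pos

theorem irreducible (h : HasCentreRadius v φ l) : Irreducible φ := by
  cases h with
  | gauss _ _ _ _ hd _ =>
    exact irreducible_of_degree_eq_one ((degree_eq_iff_natDegree_eq_of_pos one_pos).2 hd)
  | augment _ _ _ _ _ _ _ val key _ _ => exact key.irreducible_of_isVal val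

theorem apply_centre (h : HasCentreRadius v φ l) : v φ = l := by
  cases h with
  | gauss _ _ hv monic _ integral =>
    refine le_antisymm (hv.apply_le_zero monic) ?_
    rw [hv φ]
    exact Finset.le_inf fun i _ => integral i
  | augment _ _ _ _ _ _ _ _ key _ aug => exact aug.apply_self key.monic key.natDegree_pos

theorem isVal (h : HasCentreRadius v φ l) (hl : l ≠ ⊤) : IsVal v := by
  cases h with
  | gauss _ _ hv _ _ _ => exact hv.isVal
  | augment _ _ _ _ _ _ _ val key _ aug =>
    exact aug.isVal key.monic key.natDegree_pos val hl

/-- The radius bounds the values of all monic polynomials of degree at most `deg v`. -/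
theorem apply_le_radius (h : HasCentreRadius v φ l) {g : K[X]} (hg : g.Monic)
    (hd : g.natDegree ≤ φ.natDegree) : v g ≤ l := by
  have hX := h.extends_vK.2
  cases h with
  | gauss _ _ hv _ _ _ => exact hv.apply_le_zero hg
  | augment _ _ _ _ _ _ _ _ key _ aug =>
    -- Padding with powers of x reaches degree deg φ, and does not lower the value because v x ≥ 0.
    have h1 : v (X ^ (φ.natDegree - g.natDegree) * g) ≤ l := by
      refine aug.apply_le key.monic key.natDegree_pos ((monic_X_pow _).mul hg) ?_
      rw [(monic_X_pow _).natDegree_mul hg, natDegree_X_pow]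
      omega
    refine le_trans ?_ h1
    rw [AddValuation.map_mul, AddValuation.map_pow]
    exact le_add_of_nonneg_left (nsmul_nonneg hX _)

/-- Key polynomials over a MacLane valuation have at least its degree. -/
theorem natDegree_le_of_isKeyPoly (h : HasCentreRadius v φ l) {χ : K[X]} (hχ : IsKeyPoly v χ) :
    φ.natDegree ≤ χ.natDegree := by
  have hirr := h.irreducible
  cases h with
  | gauss _ _ _ _ hd _ => exact hd.trans_le hχ.natDegree_pos
  | augment u _ _ _ _ _ _ val key lt aug =>
    by_contra! hlt
    have hcop : IsCoprime χ φ := by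
      refine (hirr.coprime_iff_not_dvd.2 fun hd => ?_).symm
      exact absurd (natDegree_le_of_dvd hd hχ.monic.ne_zero) (not_le.2 hlt)
    obtain ⟨a, b, hab⟩ := hcop
    -- A reduced inverse of χ modulo φ. Under u nothing cancels, so u(cφ) ≥ 0; passing to v raises
    -- the value of φ and makes v(cφ) > 0. Then χ v-divides 1, against v-minimality.
    obtain ⟨c, hc⟩ : ∃ c : K[X], a %ₘ φ * χ = 1 - c * φ := by
      refine ⟨b + a /ₘ φ * χ, ?_⟩
      rw [modByMonic_eq_sub_mul_div, ← hab]
      ring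
    have hu : 0 ≤ u (a %ₘ φ * χ) := by
      have := apply_sub_mul_le_of_not_vDvd (key.not_vDvd_mul
        (natDegree_modByMonic_lt_of_pos key.monic key.natDegree_pos a) hlt) (-c)
      have h1 : a %ₘ φ * χ - -c * φ = 1 := by rw [hc]; ring
      rwa [h1, AddValuation.map_one] at this
    have hcφ : 0 ≤ u (c * φ) := by
      have : c * φ = 1 - a %ₘ φ * χ := by rw [hc]; ring
      rw [this]
      exact (le_min (AddValuation.map_one u).ge hu).trans (AddValuation.map_sub _ _ _)
    have hpos : 0 < v (c * φ) := by
      rw [AddValuation.map_mul, aug.apply_self key.monic key.natDegree_pos]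
      by_cases hct : u c = ⊤
      · rw [top_le_iff.1 (hct.symm.trans_le (aug.le_apply key lt.le c)), top_add]
        exact WithTop.coe_lt_top 0
      · rw [AddValuation.map_mul] at hcφ
        exact (hcφ.trans_lt (WithTop.add_lt_add_left hct lt)).trans_le
          (add_le_add_left (aug.le_apply key lt.le c) _)
    have hdvd : VDvd v χ 1 := by
      refine ⟨a %ₘ φ, ?_⟩
      rwa [hc, sub_sub_cancel, AddValuation.map_one]
    exact absurd (hχ.minimal 1 hdvd) (by simpa using hχ.natDegree_pos.ne')

/-- A pseudo-valuation above a MacLane valuation `v` coincides with it in degrees below `deg v`,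
and polynomials of degree `deg v` at which it is larger are key polynomials over `v`. -/
theorem natDegree_le_of_apply_lt (h : HasCentreRadius v φ l) {u : PseudoVal K}
    (hC : ∀ c : K, u (C c) = vK K c) (hvu : ∀ g : K[X], v g ≤ u g) {g : K[X]}
    (hg : v g < u g) : φ.natDegree ≤ g.natDegree := by
  classical
  have hex : ∃ n, ∃ a : K[X], v a < u a ∧ a.natDegree = n := ⟨_, g, hg, rfl⟩
  obtain ⟨a, ha, hn⟩ := Nat.find_spec hex
  have hmin : ∀ b : K[X], v b < u b → a.natDegree ≤ b.natDegree := fun b hb => by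
    rw [hn]
    exact Nat.find_min' hex ⟨b, hb, rfl⟩
  have ha0 : a ≠ 0 := by
    rintro rfl
    simp at ha
  -- Both pseudo-valuations agree on constants, so the separating polynomial of least degree can be
  -- made monic.
  have hscale : ∀ w : PseudoVal K, (∀ c : K, w (C c) = vK K c) →
      w (a * C a.leadingCoeff⁻¹) = w a + vK K a.leadingCoeff⁻¹ := fun w hw => by
    rw [AddValuation.map_mul, hw]
  have hdeg : (a * C a.leadingCoeff⁻¹).natDegree = a.natDegree :=
    natDegree_mul_C (inv_ne_zero (leadingCoeff_ne_zero.2 ha0))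
  have hlt : v (a * C a.leadingCoeff⁻¹) < u (a * C a.leadingCoeff⁻¹) := by
    rw [hscale v h.extends_vK.1, hscale u hC]
    exact WithTop.add_lt_add_right
      (vK_ne_top K (inv_ne_zero (leadingCoeff_ne_zero.2 ha0))) ha
  have hpos : 0 < a.natDegree := by
    by_contra! h0
    rw [eq_C_of_natDegree_le_zero h0, h.extends_vK.1, hC] at ha
    exact lt_irrefl _ ha
  have hkey : IsKeyPoly v (a * C a.leadingCoeff⁻¹) :=
    IsKeyPoly.of_minimal hvu (monic_mul_leadingCoeff_inv ha0) (hdeg ▸ hpos) hlt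
      (fun b hb => hdeg ▸ hmin b hb)
  exact (h.natDegree_le_of_isKeyPoly hkey).trans (hdeg.le.trans (hmin g hg))

theorem apply_eq_of_natDegree_lt (h : HasCentreRadius v φ l) {u : PseudoVal K}
    (hC : ∀ c : K, u (C c) = vK K c) (hvu : ∀ g : K[X], v g ≤ u g) {g : K[X]}
    (hg : g.natDegree < φ.natDegree) : v g = u g :=
  (hvu g).antisymm (not_lt.1 fun hlt =>
    absurd (h.natDegree_le_of_apply_lt hC hvu hlt) (not_le.2 hg))

/-- Strictly above a MacLane pseudo-valuation the degree or the radius is larger. -/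
theorem eq_of_le {w : PseudoVal K} {ψ : K[X]} {m : WithTop ℚ} (h : HasCentreRadius v φ l)
    (hw : HasCentreRadius w ψ m) (hvw : ∀ g : K[X], v g ≤ w g)
    (hd : ψ.natDegree ≤ φ.natDegree) (hm : m ≤ l) : v = w := by
  have hlow : ∀ a : K[X], a.natDegree < φ.natDegree → w a ≤ v a := fun a ha =>
    (h.apply_eq_of_natDegree_lt hw.extends_vK.1 hvw ha).ge
  -- The centre of w already has value at least m under v: in equal degrees ψ − φ has lower degree,
  -- where v and w agree. Minimality of the augmentation then forces w ≤ v.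
  have hψ : m ≤ v ψ := by
    rcases hd.lt_or_eq with hlt | heq
    · exact hw.apply_centre.ge.trans (hlow ψ hlt)
    · have hφ : m ≤ v φ := h.apply_centre.symm ▸ hm
      have ha : (ψ - φ).natDegree < φ.natDegree := by
        exact IsMonicOfDegree.natDegree_sub_lt h.natDegree_pos.ne' ⟨heq, hw.monic⟩ ⟨rfl, h.monic⟩
      have hwa : m ≤ v (ψ - φ) := by
        refine le_trans ?_ (hlow _ ha)
        exact (le_min hw.apply_centre.ge (hφ.trans (hvw φ))).trans (AddValuation.map_sub _ _ _)
      have := AddValuation.map_add v (ψ - φ) φ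
      rw [sub_add_cancel] at this
      exact (le_min hwa hφ).trans this
  refine AddValuation.ext fun g => (hvw g).antisymm ?_
  cases hw with
  | gauss _ _ hg _ _ _ => exact hg.le_apply h g
  | augment _ _ _ _ _ _ _ _ key _ aug =>
    refine aug.apply_le_of_le key.monic key.natDegree_pos (fun a ha => ?_) hψ g
    rw [← aug.apply_of_lt key.monic ha]
    exact hlow a (ha.trans_le hd)

end HasCentreRadius

end Radius

/-! ### Discoids and evaluation at roots -/

section Discoid

variable {K : Type*} [Field K] [Valued K ℤᵐ⁰] {L : Type*} [Field L] [Algebra K L]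

theorem lt_radius_of_below {v w : PseudoVal K} (hv : IsMacLane v) (hw : IsMacLane w)
    (hvw : Below v w) (hd : degree w ≤ degree v) : radius v < radius w := by
  obtain ⟨φ, l, h⟩ := hv
  obtain ⟨ψ, m, h'⟩ := hw
  rw [h.degree_eq, h'.degree_eq] at hd
  rw [h.radius_eq, h'.radius_eq]
  by_contra! hle
  exact hvw.2 (h.eq_of_le h' hvw.1 hd hle)

/-- The centre of `v` has value at least `λ_v` on the discoid of `v`. -/
theorem HasCentreRadius.exists_isLeast {v : PseudoVal K} {φ : K[X]} {l : WithTop ℚ}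
    (h : HasCentreRadius v φ l) {s : Set L} (hs : s ⊆ discoid L v) (hfin : s.Finite)
    (hne : s.Nonempty) :
    ∃ m, l ≤ m ∧ IsLeast ((fun r => vKbar K (aeval r φ)) '' s) m := by
  obtain ⟨r, hr, hmin⟩ := Set.exists_min_image s (fun r => vKbar K (aeval r φ)) hfin hne
  refine ⟨_, h.apply_centre.ge.trans (hs hr φ), ⟨r, hr, rfl⟩, ?_⟩
  rintro _ ⟨t, ht, rfl⟩
  exact hmin t ht

variable [CompleteSpace K] [Algebra.IsAlgebraic K L]

/-- Evaluation at an algebraic element is a pseudo-valuation on `K[x]` extending `v_K`. -/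
theorem exists_pseudoVal_aeval (hK : Function.Surjective (Valued.v : K → ℤᵐ⁰)) (α : L) :
    ∃ u : PseudoVal K, (∀ g, u g = vKbar K (aeval α g)) ∧ ∀ c, u (C c) = vK K c := by
  obtain ⟨w, hw⟩ := exists_addValuation_vKbar K (L := L) hK
  refine ⟨w.comap (aeval α : K[X] →ₐ[K] L).toRingHom, fun g => hw _, fun c => ?_⟩
  refine (hw _).trans ?_
  rw [← vKbar_algebraMap (L := L)]
  congr 1
  exact aeval_C α c

/-- If a monic polynomial `g` of degree at most `deg v` has values larger than `λ_v` on a nonempty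
subset `s` of the discoid of `v`, then some MacLane valuation `w > v` of the same degree has a
discoid containing `s`. -/
theorem HasCentreRadius.exists_below {v : PseudoVal K} {φ : K[X]} {l : WithTop ℚ}
    (hK : Function.Surjective (Valued.v : K → ℤᵐ⁰)) (h : HasCentreRadius v φ l) {s : Set L}
    (hs : s ⊆ discoid L v) (hne : s.Nonempty) {g : K[X]} (hg : g.Monic)
    (hd : g.natDegree ≤ φ.natDegree) {m : WithTop ℚ} (hlm : l < m)
    (hm : ∀ r ∈ s, m ≤ vKbar K (aeval r g)) :
    ∃ w : PseudoVal K, IsMacLane w ∧ IsVal w ∧ Below v w ∧ degree w = degree v ∧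
      s ⊆ discoid L w := by
  -- One point of s suffices to recognise g as a key polynomial; the others enter only in the
  -- inclusion of s in the new discoid.
  obtain ⟨r₀, hr₀⟩ := hne
  obtain ⟨u₀, hu₀, hC₀⟩ := exists_pseudoVal_aeval hK r₀
  have hvu₀ : ∀ a, v a ≤ u₀ a := fun a => (hs hr₀ a).trans (hu₀ a).ge
  have hvg : v g ≤ l := h.apply_le_radius hg hd
  have hlt : v g < u₀ g := (hvg.trans_lt hlm).trans_le ((hm r₀ hr₀).trans (hu₀ g).ge)
  have hdeg : g.natDegree = φ.natDegree :=
    hd.antisymm (h.natDegree_le_of_apply_lt hC₀ hvu₀ hlt)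
  have hkey : IsKeyPoly v g := IsKeyPoly.of_minimal hvu₀ hg (hdeg ▸ h.natDegree_pos) hlt
    fun a ha => hdeg.trans_le (h.natDegree_le_of_apply_lt hC₀ hvu₀ ha)
  -- A finite radius is chosen even when m = ∞, since the cluster condition tests valuations only.
  obtain ⟨k, hlk, hkm⟩ : ∃ k : ℚ, l < k ∧ (k : WithTop ℚ) ≤ m := by
    lift l to ℚ using hlm.ne_top
    induction m with
    | top => exact ⟨l + 1, WithTop.coe_lt_coe.2 (lt_add_one l), le_top⟩
    | coe m => exact ⟨m, hlm, le_rfl⟩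
  have hvk : v g < k := hvg.trans_lt hlk
  have hval : IsVal v := h.isVal hlm.ne_top
  obtain ⟨w, hw⟩ := hkey.exists_isAugmentation hvk.le (WithTop.coe_ne_top (a := k))
  have hcr : HasCentreRadius w g k := .augment v φ l w g k h hval hkey hvk hw
  refine ⟨w, ⟨g, k, hcr⟩, hcr.isVal WithTop.coe_ne_top,
    ⟨hw.le_apply hkey hvk.le, fun hvw => ?_⟩, by rw [hcr.degree_eq, h.degree_eq, hdeg], ?_⟩
  · rw [hvw, hcr.apply_centre] at hvk
    exact lt_irrefl _ hvk
  · intro r hr a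
    obtain ⟨u, hu, -⟩ := exists_pseudoVal_aeval hK r
    rw [← hu]
    refine hw.apply_le_of_le hg hkey.natDegree_pos (fun b _ => (hs hr b).trans (hu b).ge) ?_ a
    exact hkm.trans ((hm r hr).trans (hu g).ge)

end Discoid

end

end MacLane

/-! ### The characterisation of clusters by the radius -/

open MacLane in
theorem lemma4p13 {K : Type*} [Field K] [Valued K ℤᵐ⁰] [CompleteSpace K]
    (hK : Function.Surjective (Valued.v : K → ℤᵐ⁰))
    {Kbar : Type*} [Field Kbar] [Algebra K Kbar] [IsAlgClosure K Kbar]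
    (f : K[X]) (hf : f.Separable)
    (hint : ∀ i, 0 ≤ MacLane.vK K (f.coeff i / f.leadingCoeff))
    (v : MacLane.PseudoVal K) (hv : MacLane.IsMacLane v)
    (s : Set Kbar) (hs : s = MacLane.discoid Kbar v ∩ f.rootSet Kbar) :
    MacLane.IsCluster f s v ↔
      IsGreatest {m : WithTop ℚ | ∃ g : K[X], g.Monic ∧ Irreducible g ∧
          g.natDegree ≤ MacLane.degree v ∧
          IsLeast ((fun r => MacLane.vKbar K (aeval r g)) '' s) m}
        (MacLane.radius v) := by
  have := IsAlgClosure.isAlgebraic (R := K) (K := Kbar)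
  have hfin : s.Finite := hs ▸ (f.rootSet_finite Kbar).subset Set.inter_subset_right
  have hsub : s ⊆ discoid Kbar v := hs ▸ Set.inter_subset_left
  obtain ⟨φ, l, h⟩ := hv
  rw [h.radius_eq]
  constructor
  · intro hcl
    -- The upper bound holds without irreducibility, which matters only for the centre φ attaining
    -- it.
    have hub : ∀ g : K[X], g.Monic → g.natDegree ≤ degree v → ∀ m,
        IsLeast ((fun r => vKbar K (aeval r g)) '' s) m → m ≤ l := by
      intro g hg hd m hm
      by_contra! hlm
      obtain ⟨w, hw, hwval, hvw, hdw, hsw⟩ := h.exists_below hK hsub hcl.nonempty hg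
        (hd.trans_eq h.degree_eq) hlm fun r hr => hm.2 ⟨r, hr, rfl⟩
      refine (hcl.degree_lt w hw hwval hvw (Set.Subset.antisymm ?_ ?_)).ne' hdw
      · exact Set.subset_inter hsw (hs ▸ Set.inter_subset_right)
      · rw [hs]
        exact Set.inter_subset_inter_left _ fun r hr a => (hvw.1 a).trans (hr a)
    obtain ⟨m, hlm, hm⟩ := h.exists_isLeast hsub hfin hcl.nonempty
    obtain rfl : m = l := (hub φ h.monic h.degree_eq.ge m hm).antisymm hlm
    exact ⟨⟨φ, h.monic, h.irreducible, h.degree_eq.ge, hm⟩,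
      fun k ⟨g, hg, _, hd, hk⟩ => hub g hg hd k hk⟩
  · rintro ⟨⟨g, -, -, -, hg⟩, hub⟩
    have hne : s.Nonempty := Set.image_nonempty.1 ⟨l, hg.1⟩
    refine ⟨⟨φ, l, h⟩, hs, hne, fun w hw _ hvw hsw => ?_⟩
    by_contra! hd
    have hlt := lt_radius_of_below ⟨φ, l, h⟩ hw hvw hd
    obtain ⟨ψ, m, h'⟩ := hw
    -- The centre ψ of w competes in the maximum, with minimum k on s at least the radius of w,
    -- hence above λ_v.
    obtain ⟨k, hmk, hk⟩ := h'.exists_isLeast (hsw ▸ Set.inter_subset_left) hfin hne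
    rw [h.radius_eq, h'.radius_eq] at hlt
    exact absurd (hub ⟨ψ, h'.monic, h'.irreducible, h'.degree_eq.ge.trans hd, hk⟩)
      (not_le.2 (hlt.trans_le hmk))
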